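/- Let $\Gamma$ be a finite simplicial graph with vertex set $V$ whose edges $e$ are labeled by integers $m(e)\ge 2$. For $m \geq 2$ let $\mathrm{Prod}(a,b,m)$ be the alternating word $aba\cdots$ of length $m$. Let $$A=A[\Gamma]=\langle \sigma_x\ (x\in V)\mid \mathrm{Prod}(\sigma_x,\sigma_y,m(e))=\mathrm{Prod}(\sigma_y,\sigma_x,m(e))\text{ for each edge } e=\{x,y\}\rangle$$ be the Artin group of $\Gamma$, and let $W$ be the Coxeter group of $\Gamma$, which has generators $s_x$ ($x\in V$), the corresponding relations, and the relations $s_x^2=1$. Let $\theta:A\to W$ be the epimorphism with $\theta(\sigma_x)=s_x$, and let $CA=\ker\theta$ be the colored Artin group. Let $X\subset V$. Let $\Gamma_X$ be the full subgraph spanned by $X$ with the induced labeling, $S_X=\{s_x\mid x\in X\}$, $W_X=\langle S_X\rangle\subset W$, $\Sigma_X=\{\sigma_x\mid x\in X\}$, $A_X=\langle\Sigma_X\rangle\subset A$, and $CA_X=CA\cap A_X$. Write $\Sigma = \Sigma_V$. An element $w\in W$ is called $(X,\emptyset)$-minimal if it has minimal word length, with respect to the generators $s_x$ ($x\in V$),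 in the coset $W_Xw$. Every $u\in W$ can be written uniquely as $u=vw$ with $v\in W_X$ and $w$ $(X,\emptyset)$-minimal. Define a map $\hat\pi_X$ from words over $\Sigma\sqcup\Sigma^{-1}$ to words over $\Sigma_X\sqcup\Sigma_X^{-1}$ as follows. Let $\hat\alpha=\sigma_{z_1}^{\varepsilon_1}\cdots\sigma_{z_p}^{\varepsilon_p}$ with $\varepsilon_i\in\{1,-1\}$. For $0\le i\le p$ put $u_i=s_{z_1}\cdots s_{z_i}$ (so $u_0=1$) and write $u_i=v_iw_i$ with $v_i\in W_X$ and $w_i$ $(X,\emptyset)$-minimal. For $1\le i\le p$ put $t_i=w_{i-1}s_{z_i}w_{i-1}^{-1}$ if $\varepsilon_i=1$ and $t_i=w_is_{z_i}w_i^{-1}$ if $\varepsilon_i=-1$. If $t_i=s_{x_i}$ with $x_i\in X$, put $\tau_i=\sigma_{x_i}^{\varepsilon_i}$; if $t_i\notin S_X$, let $\tau_i$ be the empty word. Then $\hat\pi_X(\hat\alpha)=\tau_1\cdots\tau_p$. The following hold. 1. If two words $\hat\alpha,\hat\beta$ over $\Sigma\sqcup\Sigma^{-1}$ represent the same element of $A$,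 then $\hat\pi_X(\hat\alpha)$ and $\hat\pi_X(\hat\beta)$ represent the same element of the Artin group $A[\Gamma_X]$, and hence also of $A_X$. Thus there is a unique set map $\pi_X:A\to A_X$ which sends, for every word $\hat\alpha$, the element represented by $\hat\alpha$ to the element represented by $\hat\pi_X(\hat\alpha)$. 2. $\pi_X(\alpha)=\alpha$ for all $\alpha\in A_X$. 3. The restriction of $\pi_X$ to $CA$ is a homomorphism $CA\to CA_X$; in particular $\pi_X(CA)\subset CA_X$. -/

import Mathlib

noncomputable section

/-- A simplicial graph on the vertex set `V` with a labeling of its edges by integers `≥ 2`. -/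
structure LabeledGraph (V : Type*) where
  graph : SimpleGraph V
  label : graph.edgeSet → ℕ
  two_le_label : ∀ e, 2 ≤ label e

/-- The alternating product `a * b * a * ⋯` with `n` factors. -/
def altProd {G : Type*} [Monoid G] (a b : G) : ℕ → G
  | 0 => 1
  | n + 1 => a * altProd b a n

theorem map_altProd {G H : Type*} [Monoid G] [Monoid H] (f : G →* H) (a b : G) (n : ℕ) :
    f (altProd a b n) = altProd (f a) (f b) n := by
  induction n generalizing a b with
  | zero => simp [altProd]
  | succ n ih => simp [altProd, ih]

theorem altProd_mul_inv_altProd {G : Type*} [Group G] {a b : G} (ha : a * a = 1) (hb : b * b = 1)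
    (n : ℕ) : altProd a b n * (altProd b a n)⁻¹ = (a * b) ^ n := by
  induction n generalizing a b with
  | zero => simp [altProd]
  | succ n ih =>
    have hb' : b⁻¹ = b := inv_eq_of_mul_eq_one_right hb
    simp only [altProd, mul_inv_rev, hb']
    rw [show a * altProd b a n * ((altProd a b n)⁻¹ * b)
      = a * (altProd b a n * (altProd a b n)⁻¹) * b by simp only [mul_assoc], ih hb ha]
    clear ih
    induction n with
    | zero => simp
    | succ n ihn =>
      rw [pow_succ' (b * a), pow_succ' (a * b), ← ihn]
      simp only [mul_assoc]

namespace LabeledGraph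

variable {V : Type*} (Γ : LabeledGraph V)

/-- The full subgraph spanned by `X`, with the induced labeling. -/
def induce (X : Set V) : LabeledGraph X where
  graph := Γ.graph.induce X
  label e := Γ.label ((SimpleGraph.Embedding.induce X).toHom.mapEdgeSet e)
  two_le_label _ := Γ.two_le_label _

/-! ### Artin groups -/

/-- The relators `Prod(σ_x, σ_y, m(e)) * Prod(σ_y, σ_x, m(e))⁻¹`, one for each pair `x, y` of
vertices joined by an edge `e`. -/
def artinRels : Set (FreeGroup V) :=
  {r | ∃ (x y : V) (h : Γ.graph.Adj x y),
    r = altProd (FreeGroup.of x) (FreeGroup.of y) (Γ.label ⟨s(x, y), h⟩) *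
      (altProd (FreeGroup.of y) (FreeGroup.of x) (Γ.label ⟨s(x, y), h⟩))⁻¹}

/-- The Artin group `A = A[Γ]`. -/
abbrev ArtinGroup : Type _ := PresentedGroup Γ.artinRels

/-- The standard generator `σ_x` of `A`. -/
def artinGen (x : V) : Γ.ArtinGroup := PresentedGroup.of x

/-- The element of `A` represented by a word over `Σ ⊔ Σ⁻¹`. The letter `(x, true)` is `σ_x` and
the letter `(x, false)` is `σ_x⁻¹`. -/
def artinWord (α : List (V × Bool)) : Γ.ArtinGroup :=
  (α.map fun l => if l.2 then Γ.artinGen l.1 else (Γ.artinGen l.1)⁻¹).prod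

/-- The standard parabolic subgroup `A_X` of `A`, generated by the `σ_x` with `x ∈ X`. -/
def artinParabolic (X : Set V) : Subgroup Γ.ArtinGroup :=
  Subgroup.closure (Γ.artinGen '' X)

/-! ### Coxeter groups -/

open Classical in
/-- The Coxeter matrix of `Γ`: its entry at `(x, y)` is `1` if `x = y`, the label of the edge
`{x, y}` if there is one, and otherwise `0`, which stands for the absence of a relation. -/
def coxeterMatrix : CoxeterMatrix V where
  M := Matrix.of fun x y =>
    if x = y then 1 else if h : Γ.graph.Adj x y then Γ.label ⟨s(x, y), h⟩ else 0
  isSymm := by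
    ext x y
    by_cases hxy : x = y
    · simp [hxy]
    · by_cases h : Γ.graph.Adj x y
      · simp [hxy, Ne.symm hxy, h, h.symm, Sym2.eq_swap]
      · have h' : ¬ Γ.graph.Adj y x := fun k => h k.symm
        simp [hxy, Ne.symm hxy, h, h']
  diagonal := by simp
  off_diagonal x y hxy := by
    by_cases h : Γ.graph.Adj x y
    · have := Γ.two_le_label ⟨s(x, y), h⟩
      simp only [Matrix.of_apply, hxy, h, if_false, dif_pos]
      omega
    · simp [hxy, h]

theorem coxeterMatrix_of_adj {x y : V} (h : Γ.graph.Adj x y) :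
    Γ.coxeterMatrix x y = Γ.label ⟨s(x, y), h⟩ := by
  simp [coxeterMatrix, h, h.ne]

/-- The Coxeter group `W = W[Γ]`. -/
abbrev CoxeterGroup : Type _ := Γ.coxeterMatrix.Group

/-- `W` with its standard generators as a Coxeter system. -/
abbrev coxeterSystem : CoxeterSystem Γ.coxeterMatrix Γ.CoxeterGroup :=
  Γ.coxeterMatrix.toCoxeterSystem

/-- The standard generator `s_x` of `W`. -/
abbrev coxeterGen (x : V) : Γ.CoxeterGroup := Γ.coxeterSystem.simple x

/-- The standard parabolic subgroup `W_X` of `W`, generated by the `s_x` with `x ∈ X`. -/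
def coxeterParabolic (X : Set V) : Subgroup Γ.CoxeterGroup :=
  Subgroup.closure (Γ.coxeterGen '' X)

/-- `w` is `(X, Y)`-minimal: it is of minimal length in the double coset `W_X w W_Y`. -/
def IsMinimal (X Y : Set V) (w : Γ.CoxeterGroup) : Prop :=
  ∀ v ∈ DoubleCoset.doubleCoset w (Γ.coxeterParabolic X : Set Γ.CoxeterGroup)
    (Γ.coxeterParabolic Y), Γ.coxeterSystem.length w ≤ Γ.coxeterSystem.length v

theorem exists_minimal_decomposition (X : Set V) (u : Γ.CoxeterGroup) :
    ∃ w, Γ.IsMinimal X ∅ w ∧ ∃ v ∈ Γ.coxeterParabolic X, u = v * w := by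
  obtain ⟨_, ⟨v, rfl⟩, hv⟩ := wellFounded_lt.has_min
    (Set.range fun v : Γ.coxeterParabolic X => Γ.coxeterSystem.length ((v : Γ.CoxeterGroup) * u))
    ⟨_, 1, rfl⟩
  refine ⟨v * u, ?_, (v : Γ.CoxeterGroup)⁻¹, inv_mem v.2, by group⟩
  intro y hy
  obtain ⟨a, ha, b, hb, rfl⟩ := DoubleCoset.mem_doubleCoset.1 hy
  have hb1 : b = 1 := by simpa [coxeterParabolic] using hb
  subst hb1
  have := hv _ ⟨⟨a, ha⟩ * v, rfl⟩
  simpa [mul_assoc] using this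

/-- The `(X, ∅)`-minimal factor `w` in a decomposition `u = v * w` with `v ∈ W_X`. -/
def minimalPart (X : Set V) (u : Γ.CoxeterGroup) : Γ.CoxeterGroup :=
  (Γ.exists_minimal_decomposition X u).choose

theorem minimalPart_spec (X : Set V) (u : Γ.CoxeterGroup) :
    Γ.IsMinimal X ∅ (Γ.minimalPart X u) ∧
      ∃ v ∈ Γ.coxeterParabolic X, u = v * Γ.minimalPart X u :=
  (Γ.exists_minimal_decomposition X u).choose_spec

/-! ### The colored Artin group -/

/-- The natural epimorphism `θ : A → W` sending `σ_x` to `s_x`. -/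
def theta : Γ.ArtinGroup →* Γ.CoxeterGroup :=
  PresentedGroup.toGroup (f := Γ.coxeterGen) <| by
    rintro _ ⟨x, y, h, rfl⟩
    rw [map_mul, map_inv, map_altProd, map_altProd, FreeGroup.lift_apply_of,
      FreeGroup.lift_apply_of, altProd_mul_inv_altProd (Γ.coxeterSystem.simple_mul_simple_self x)
        (Γ.coxeterSystem.simple_mul_simple_self y), ← Γ.coxeterMatrix_of_adj h]
    exact Γ.coxeterSystem.simple_mul_simple_pow x y

/-- The colored Artin group `CA`, the kernel of `θ`. -/
def coloredArtin : Subgroup Γ.ArtinGroup := Γ.theta.ker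

/-- `CA_X = CA ∩ A_X`. -/
def coloredArtinParabolic (X : Set V) : Subgroup Γ.ArtinGroup :=
  Γ.coloredArtin ⊓ Γ.artinParabolic X

/-! ### The map on words -/

open Classical in
/-- For a letter `σ_z ^ ε`, read at the element `u` of `W` that precedes it, the word `τ` over
`Σ_X ⊔ Σ_X⁻¹`: it is empty or a single letter. Here `t` is conjugate to `s_z` by the
`(X, ∅)`-minimal part of `u` if `ε = 1`, and by that of `u * s_z` if `ε = -1`. -/
def piHatLetter (X : Set V) (u : Γ.CoxeterGroup) (z : V) (ε : Bool) : List (X × Bool) :=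
  let w := if ε then Γ.minimalPart X u else Γ.minimalPart X (u * Γ.coxeterGen z)
  let t := w * Γ.coxeterGen z * w⁻¹
  if h : ∃ x : X, t = Γ.coxeterGen x then [(h.choose, ε)] else []

/-- The concatenation of the words `τ_i` for a word read from the element `u` of `W` on. -/
def piHatFrom (X : Set V) : Γ.CoxeterGroup → List (V × Bool) → List (X × Bool)
  | _, [] => []
  | u, (z, ε) :: α => Γ.piHatLetter X u z ε ++ piHatFrom X (u * Γ.coxeterGen z) α

/-- The map from words over `Σ ⊔ Σ⁻¹` to words over `Σ_X ⊔ Σ_X⁻¹`. -/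
def piHat (X : Set V) (α : List (V × Bool)) : List (X × Bool) :=
  Γ.piHatFrom X 1 α

/-- A word over `Σ_X ⊔ Σ_X⁻¹`, regarded as a word over `Σ ⊔ Σ⁻¹`. -/
def includeWord (X : Set V) (τ : List (X × Bool)) : List (V × Bool) :=
  τ.map fun l => (l.1.1, l.2)

/-- The set map `π : A → A_X` is induced by `piHat`: it sends the element represented by a word
`α` to the element represented by the word `piHat α`. -/
def IsInducedByPiHat (X : Set V) (π : Γ.ArtinGroup → Γ.artinParabolic X) : Prop :=
  ∀ α : List (V × Bool),
    (π (Γ.artinWord α) : Γ.ArtinGroup) = Γ.artinWord (includeWord X (Γ.piHat X α))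

end LabeledGraph

end

/-! The output of `piHat` is a cocycle. Read a word while tracking a point u = vw of W, with v ∈ W_X
and w minimal. For a positive letter σ_z, Deodhar's lemma leaves two cases: either w s_z w⁻¹ = s_x
with x ∈ X, and then v becomes v s_x, w stays and σ_x is put out; or w s_z is again minimal, v stays
and nothing is put out. A negative letter runs such a step backwards. So the output, as a function
of the starting point, is the first component of a map to (W → A[Γ_X]) ⋊ W. Well-definedness says
that this map respects the braid relations (`stepHom`).

Each side of a braid relation of length m has m distinct inversions, because s_x s_y has order
exactly m (`dvd_of_simple_mul_simple_pow_eq_one`, by the geometric representation). Up to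
conjugation, the inversions of the output are a sublist of those of the input
(`leftInvSeq_outWord_sublist`). Hence they are distinct too, and both outputs are reduced; they also
represent the same element of W_X. Matsumoto's theorem (`prod_map_eq_of_isReduced`) makes them equal
in A[Γ_X]. It is stated for letters in X with reducedness measured in W, so that W_X need not be
compared with the Coxeter group of Γ_X.

The rest follows from `output_mul`. On A_X, started at 1, the minimal part stays 1 and letters are
copied. On CA the tracked point returns to its start, so the cocycle is a homomorphism, and v
returns too, so its values are colored. -/

/-- A permutation action of `G` on `T` induces an action on functions on `T` by automorphisms. -/
def funAut {G T N : Type*} [Group G] [Group N] (ρ : G →* Equiv.Perm T) : G →* MulAut (T → N) where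
  toFun g :=
    { toFun := fun f t => f ((ρ g)⁻¹ t)
      invFun := fun f t => f (ρ g t)
      left_inv := fun f => by ext t; simp
      right_inv := fun f => by ext t; simp
      map_mul' := fun f f' => rfl }
  map_one' := by ext f t; simp
  map_mul' g h := by ext f t; simp [MulAut.mul_apply]

@[simp]
theorem funAut_apply {G T N : Type*} [Group G] [Group N] (ρ : G →* Equiv.Perm T) (g : G)
    (f : T → N) (t : T) : funAut ρ g f t = f ((ρ g)⁻¹ t) := rfl

/-- The alternating word `a b a ⋯` with `n` letters. -/
def altList {B : Type*} (a b : B) : ℕ → List B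
  | 0 => []
  | n + 1 => a :: altList b a n

@[simp]
theorem length_altList {B : Type*} (a b : B) (n : ℕ) : (altList a b n).length = n := by
  induction n generalizing a b with
  | zero => rfl
  | succ n ih => simp [altList, ih]

theorem prod_map_altList {B G : Type*} [Monoid G] (f : B → G) (a b : B) (n : ℕ) :
    ((altList a b n).map f).prod = altProd (f a) (f b) n := by
  induction n generalizing a b with
  | zero => rfl
  | succ n ih => simp [altList, altProd, ih]

theorem altProd_two_mul {G : Type*} [Monoid G] (a b : G) (n : ℕ) :
    altProd a b (2 * n) = (a * b) ^ n := by
  induction n with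
  | zero => simp [altProd]
  | succ n ih => rw [mul_add_one, altProd, altProd, ih, pow_succ', mul_assoc]

/-! ### Inversions, their parity, and the exchange property -/

namespace CoxeterSystem

variable {B W : Type*} [Group W] {M : CoxeterMatrix B} (cs : CoxeterSystem M W)

theorem leftInvSeq_altList (a b : B) (n : ℕ) :
    cs.leftInvSeq (altList a b n) =
      (List.range n).map fun k => (cs.simple a * cs.simple b) ^ k * cs.simple a := by
  induction n generalizing a b with
  | zero => rfl
  | succ n ih =>
    rw [altList, leftInvSeq, ih, List.range_succ_eq_map]
    simp only [List.map_cons, pow_zero, one_mul, List.map_map, List.cons.injEq, true_and]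
    refine List.map_congr_left fun k _ => ?_
    simp only [Function.comp_apply, MulAut.conj_apply, inv_simple, pow_succ]
    have h : ∀ k : ℕ, cs.simple a * (cs.simple b * cs.simple a) ^ k =
        (cs.simple a * cs.simple b) ^ k * cs.simple a := fun k => by
      induction k with
      | zero => simp
      | succ k ih => rw [pow_succ, ← mul_assoc, ih, pow_succ]; simp only [mul_assoc]
    rw [← mul_assoc, h]
    simp only [mul_assoc]

/-- The conjugation action of a group on itself by permutations. -/
def conjPerm (W : Type*) [Group W] : W →* Equiv.Perm W where
  toFun w := (MulAut.conj w).toEquiv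
  map_one' := by ext; simp
  map_mul' w w' := by ext; simp [mul_assoc]

theorem conjPerm_inv_apply (w t : W) : (conjPerm W w)⁻¹ t = w⁻¹ * t * w := by
  rw [← map_inv]
  simp [conjPerm]

open Classical in
/-- The image of a simple reflection in the group that records parities of inversions. -/
noncomputable def parityGen (i : B) :
    (W → Multiplicative (ZMod 2)) ⋊[funAut (conjPerm W)] W :=
  ⟨fun t => Multiplicative.ofAdd (if t = cs.simple i then 1 else 0), cs.simple i⟩

-- The twist by conjugation in the semidirect product is the recursion that defines the left
-- inversion sequence.
open Classical in
theorem prod_map_parityGen (ω : List B) :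
    (ω.map cs.parityGen).prod =
      ⟨fun t => Multiplicative.ofAdd ((cs.leftInvSeq ω).count t : ZMod 2), cs.wordProd ω⟩ := by
  induction ω with
  | nil => rfl
  | cons i ω ih =>
    rw [List.map_cons, List.prod_cons, ih]
    ext t
    · have h : (cs.leftInvSeq ω).count (((conjPerm W) (cs.simple i))⁻¹ t) =
          ((cs.leftInvSeq ω).map (MulAut.conj (cs.simple i))).count t := by
        rw [← List.count_map_of_injective _ _ (MulAut.conj (cs.simple i)).injective]
        simp [conjPerm_inv_apply, mul_assoc]
      simp only [parityGen, SemidirectProduct.mul_left, Pi.mul_apply, funAut_apply, leftInvSeq,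
        List.count_cons, h, Nat.cast_add, ← ofAdd_add]
      rw [add_comm]
      rcases eq_or_ne t (cs.simple i) with ht | ht
      · simp [ht]
      · simp [ht, ht.symm]
    · simp [parityGen, wordProd_cons]

/-- The inversions of the word (ab)^m are (ab)^k a for k < 2m. Those for k and k + m coincide, so
every count is even. -/
theorem isLiftable_parityGen : M.IsLiftable cs.parityGen := by
  classical
  intro a b
  rw [← altProd_two_mul, ← prod_map_altList, prod_map_parityGen, leftInvSeq_altList]
  refine SemidirectProduct.ext (funext fun t => ?_) ?_
  · have : ((fun k => (cs.simple a * cs.simple b) ^ k * cs.simple a) ∘ fun x => M a b + x) =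
        fun k => (cs.simple a * cs.simple b) ^ k * cs.simple a := by
      ext k
      simp [pow_add]
    change Multiplicative.ofAdd _ = Multiplicative.ofAdd 0
    rw [two_mul, List.range_add, List.map_append, List.count_append, List.map_map, this,
      Nat.cast_add, CharTwo.add_self_eq_zero]
  · simp [wordProd, prod_map_altList, altProd_two_mul]

/-- The parity of the number of occurrences of `t` in the left inversion sequence of a word depends
only on the element that the word represents. -/
theorem count_leftInvSeq_parity [DecidableEq W] {ω ω' : List B}
    (h : cs.wordProd ω = cs.wordProd ω') (t : W) :
    ((cs.leftInvSeq ω).count t : ZMod 2) = (cs.leftInvSeq ω').count t := by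
  classical
  have key : ∀ ω : List B, cs.lift ⟨_, cs.isLiftable_parityGen⟩ (cs.wordProd ω) =
      (ω.map cs.parityGen).prod := fun ω => by
    rw [wordProd, map_list_prod, List.map_map]
    congr 1
    exact List.map_congr_left fun i _ => by simp
  have h' := key ω
  rw [h, key ω', prod_map_parityGen, prod_map_parityGen] at h'
  have := congrFun (congrArg SemidirectProduct.left h') t
  convert (Multiplicative.ofAdd.injective this).symm

/-- A count of one is odd, so it cannot become zero in another word for the same element. -/
theorem mem_leftInvSeq_of_nodup {ω ω' : List B} (h : cs.wordProd ω = cs.wordProd ω')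
    (hω : (cs.leftInvSeq ω).Nodup) {t : W} (ht : t ∈ cs.leftInvSeq ω) :
    t ∈ cs.leftInvSeq ω' := by
  classical
  have := cs.count_leftInvSeq_parity h t
  rw [List.count_eq_one_of_mem hω ht] at this
  by_contra hn
  rw [List.count_eq_zero.2 hn] at this
  exact absurd this (by decide)

theorem isReduced_of_nodup_leftInvSeq {ω : List B} (hω : (cs.leftInvSeq ω).Nodup) :
    cs.IsReduced ω := by
  obtain ⟨ρ, hρ, h⟩ := cs.exists_isReduced (cs.wordProd ω)
  refine le_antisymm (cs.length_wordProd_le ω) ?_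
  rw [h, hρ.eq, ← cs.length_leftInvSeq, ← cs.length_leftInvSeq ρ]
  exact (hω.subperm fun t ht => cs.mem_leftInvSeq_of_nodup h hω ht).length_le

/-- The exchange property. -/
theorem IsLeftDescent.exists_eraseIdx {cs : CoxeterSystem M W} {ω : List B} {i : B}
    (h : cs.IsLeftDescent (cs.wordProd ω) i) :
    ∃ j < ω.length, cs.simple i * cs.wordProd ω = cs.wordProd (ω.eraseIdx j) := by
  obtain ⟨ρ, hρ, hp⟩ := cs.exists_isReduced (cs.simple i * cs.wordProd ω)
  have hp' : cs.wordProd (i :: ρ) = cs.wordProd ω := by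
    rw [wordProd_cons, ← hp, simple_mul_simple_cancel_left]
  have hred : cs.IsReduced (i :: ρ) := by
    rw [IsReduced, hp', ← cs.isLeftDescent_iff.1 h, hp, hρ.eq, List.length_cons]
  -- The first inversion of the reduced word i :: ρ is s_i itself, and it must also occur in ω.
  have hmem : cs.simple i ∈ cs.leftInvSeq ω :=
    cs.mem_leftInvSeq_of_nodup hp' hred.nodup_leftInvSeq (by simp [leftInvSeq])
  obtain ⟨j, hj, he⟩ := List.mem_iff_getElem.1 hmem
  refine ⟨j, by simpa using hj, ?_⟩
  rw [← cs.getD_leftInvSeq_mul_wordProd, List.getD_eq_getElem _ 1 hj, he]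

end CoxeterSystem

/-! ### The geometric representation -/

namespace CoxeterMatrix

open Polynomial.Chebyshev Module

variable {B : Type*} (M : CoxeterMatrix B)

/-- The simple coroot of the geometric representation indexed by `i`. -/
noncomputable def coroot (i : B) : Module.Dual ℝ (B →₀ ℝ) :=
  Finsupp.linearCombination ℝ fun j => -2 * Real.cos (Real.pi / M i j)

/-- For `M i j = 0` the convention π / 0 = 0 gives -2, the usual entry for infinite order. -/
theorem coroot_single (i j : B) :
    M.coroot i (Finsupp.single j 1) = -2 * Real.cos (Real.pi / M i j) := by
  simp [coroot]

theorem coroot_single_self (i : B) : M.coroot i (Finsupp.single i 1) = 2 := by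
  simp [coroot_single]

/-- The reflection of the geometric representation indexed by `i`. -/
noncomputable def geomReflection (i : B) : (B →₀ ℝ) ≃ₗ[ℝ] (B →₀ ℝ) :=
  Module.reflection (M.coroot_single_self i)

/-- This is the point 2 cos θ, with θ = 2π/m, at which Chebyshev polynomials express the powers of a
product of two reflections. -/
theorem coroot_mul_coroot_sub_two (i j : B) :
    2 * Real.cos (2 * (Real.pi / M i j)) =
      M.coroot i (Finsupp.single j 1) * M.coroot j (Finsupp.single i 1) - 2 := by
  rw [coroot_single, coroot_single, M.symmetric j i, Real.cos_two_mul]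
  ring

theorem isLiftable_geomReflection : M.IsLiftable M.geomReflection := by
  intro i j
  rcases eq_or_ne i j with rfl | hij
  · rw [M.diagonal, pow_one]
    ext1 v
    rw [LinearEquiv.mul_apply, geomReflection, involutive_reflection]
    rfl
  have h1 := M.off_diagonal i j hij
  refine LinearEquiv.ext fun v => ?_
  rw [geomReflection, geomReflection, reflection_mul_reflection_pow_apply _ _ _ _ _
    (M.coroot_mul_coroot_sub_two i j)]
  -- The formula S_n(2 cos θ) = sin((n+1)θ) / sin θ needs sin θ ≠ 0, which holds for m ≥ 3. For m =
  -- 2, θ = π.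
  rcases (show M i j = 0 ∨ M i j = 2 ∨ 3 ≤ M i j by omega) with h | h | h
  · simp [h]
  · have h2 : 2 * Real.cos (2 * (Real.pi / 2)) = -2 := by
      rw [mul_div_cancel₀ _ two_ne_zero, Real.cos_pi, mul_neg_one]
    simp [h, coroot_single, M.symmetric j i, h2]
    module
  set m := M i j with hm
  set θ : ℝ := 2 * (Real.pi / m) with hθ
  have hm0 : (0 : ℝ) < m := by positivity
  have hsin : Real.sin θ ≠ 0 := by
    refine (Real.sin_pos_of_pos_of_lt_pi (by positivity) ?_).ne'
    have : (3 : ℝ) ≤ m := by exact_mod_cast h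
    rw [hθ, ← mul_div_assoc, div_lt_iff₀ hm0]
    nlinarith [Real.pi_pos]
  have hmθ : m * θ = 2 * Real.pi := by rw [hθ]; field_simp
  have hS := fun n : ℤ => S_two_mul_real_cos θ n
  have key : ∀ n : ℤ, (S ℝ n).eval (2 * Real.cos θ) = Real.sin ((n + 1) * θ) / Real.sin θ :=
    fun n => by rw [← hS, mul_div_cancel_right₀ _ hsin]
  obtain ⟨k, hk⟩ := Nat.even_or_odd' m
  -- The coefficients contain the factor S_{k-1} if m = 2k, where kθ = π, and S_k + S_{k-1} if m =
  -- 2k + 1, where (k+1)θ = 2π - kθ. Both vanish.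
  rcases hk with hk | hk
  · have e1 : ((m : ℤ) - 2) / 2 = k - 1 := by omega
    have e2 : ((m : ℤ) - 1) / 2 = k - 1 := by omega
    have hz : (S ℝ ((k : ℤ) - 1)).eval (2 * Real.cos θ) = 0 := by
      rw [key]
      have : (((k : ℤ) - 1 : ℤ) + 1 : ℝ) * θ = Real.pi := by
        rw [hk] at hmθ
        push_cast at hmθ ⊢
        linarith
      rw [this, Real.sin_pi, zero_div]
    simp [e1, e2, hz]
  · have e1 : ((m : ℤ) - 2) / 2 = k - 1 := by omega
    have e2 : ((m : ℤ) - 1) / 2 = k := by omega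
    have e3 : ((m : ℤ) - 3) / 2 = k - 1 := by omega
    have e4 : (m : ℤ) / 2 = k := by omega
    have hz : (S ℝ (k : ℤ)).eval (2 * Real.cos θ) + (S ℝ ((k : ℤ) - 1)).eval (2 * Real.cos θ)
        = 0 := by
      rw [key, key, ← add_div]
      have : (((k : ℤ) : ℝ) + 1) * θ = 2 * Real.pi - (((k : ℤ) - 1 : ℤ) + 1 : ℝ) * θ := by
        rw [hk] at hmθ
        push_cast at hmθ ⊢
        linarith
      rw [this, Real.sin_two_pi_sub]
      simp
    simp [e1, e2, e3, e4, hz]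

end CoxeterMatrix

/-! ### Exact orders of products of two simple reflections -/

namespace CoxeterSystem

open Polynomial.Chebyshev Module

variable {B W : Type*} [Group W] {M : CoxeterMatrix B} (cs : CoxeterSystem M W)

/-- The geometric representation of a Coxeter group. -/
noncomputable def geomRep : W →* ((B →₀ ℝ) ≃ₗ[ℝ] (B →₀ ℝ)) :=
  cs.lift ⟨M.geomReflection, M.isLiftable_geomReflection⟩

theorem geomRep_simple (i : B) : cs.geomRep (cs.simple i) = M.geomReflection i :=
  cs.lift_apply_simple M.isLiftable_geomReflection i

/-- The coordinate at i of the image of e_i is -1 under s_i, but 1 under s_j for j ≠ i. -/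
theorem simple_injective : Function.Injective cs.simple := by
  intro i j h
  by_contra hij
  have h1 := LinearEquiv.congr_fun (congrArg cs.geomRep h) (Finsupp.single i 1)
  rw [geomRep_simple, geomRep_simple, CoxeterMatrix.geomReflection, CoxeterMatrix.geomReflection,
    reflection_apply, reflection_apply, M.coroot_single_self] at h1
  have h2 := DFunLike.congr_fun h1 i
  simp [Ne.symm hij] at h2

/-- For m ≥ 3, the coordinates of (s_i s_j)^n e_i = e_i give S_{n-1} = 0 and S_n = 1 at 2 cos θ.
Thus sin nθ = 0 and cos nθ = 1, so nθ is a multiple of 2π = mθ. -/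
theorem dvd_of_simple_mul_simple_pow_eq_one {i j : B} {n : ℕ}
    (h : (cs.simple i * cs.simple j) ^ n = 1) : M i j ∣ n := by
  rcases eq_or_ne i j with rfl | hij
  · simp
  have h1 := M.off_diagonal i j hij
  rcases (show M i j = 2 ∨ M i j ≠ 2 by omega) with h2 | h2
  · rw [h2, ← even_iff_two_dvd]
    by_contra hn
    obtain ⟨k, rfl⟩ := Nat.not_even_iff_odd.1 hn
    have hm := cs.simple_mul_simple_pow i j
    rw [h2] at hm
    rw [pow_succ, pow_mul, hm, one_pow, one_mul] at h
    exact hij (cs.simple_injective (by rw [mul_eq_one_iff_eq_inv.1 h, inv_simple]))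
  have hv := LinearEquiv.congr_fun (congrArg cs.geomRep h) (Finsupp.single i 1)
  rw [map_pow, map_mul, geomRep_simple, geomRep_simple, CoxeterMatrix.geomReflection,
    CoxeterMatrix.geomReflection, reflection_mul_reflection_pow_apply_self _ _ _ _
    (M.coroot_mul_coroot_sub_two i j), map_one] at hv
  have hi := DFunLike.congr_fun hv i
  have hj := DFunLike.congr_fun hv j
  simp [hij, Ne.symm hij, CoxeterMatrix.coroot_single, M.symmetric j i] at hi hj
  set m := M i j with hm
  -- For infinite order the argument is 2 and S_{n-1}(2) = n, which forces n = 0.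
  rcases (show m = 0 ∨ 3 ≤ m by omega) with h | h
  · simp [h] at hi hj
    simp [h, hj]
  set θ : ℝ := 2 * (Real.pi / m) with hθ
  have hm0 : (0 : ℝ) < m := by positivity
  have h3 : (3 : ℝ) ≤ m := by exact_mod_cast h
  have hsin : Real.sin θ ≠ 0 := by
    refine (Real.sin_pos_of_pos_of_lt_pi (by positivity) ?_).ne'
    rw [hθ, ← mul_div_assoc, div_lt_iff₀ hm0]
    nlinarith [Real.pi_pos]
  have hcos : Real.cos (Real.pi / m) ≠ 0 := by
    refine (Real.cos_pos_of_mem_Ioo ⟨?_, ?_⟩).ne'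
    · have : 0 < Real.pi / m := by positivity
      linarith [Real.pi_pos]
    · rw [div_lt_div_iff₀ hm0 (by norm_num)]
      nlinarith [Real.pi_pos]
  have hS0 : (S ℝ ((n : ℤ) - 1)).eval (2 * Real.cos θ) = 0 := hj.resolve_right hcos
  rw [hS0, add_zero] at hi
  have h4 := S_two_mul_real_cos θ n
  have h5 := S_two_mul_real_cos θ (n - 1)
  rw [hS0, zero_mul] at h5
  rw [hi, one_mul] at h4
  push_cast at h4 h5
  rw [sub_add_cancel] at h5
  rw [add_mul, one_mul, Real.sin_add, ← h5, zero_mul, zero_add] at h4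
  have h6 : Real.cos (n * θ) = 1 := mul_right_cancel₀ hsin (by rw [one_mul]; exact h4.symm)
  obtain ⟨l, hl⟩ := (Real.cos_eq_one_iff _).1 h6
  have h7 : (n : ℝ) = l * m := by
    rw [hθ] at hl
    field_simp at hl
    linarith
  have h8 : (n : ℤ) = l * m := by exact_mod_cast h7
  exact Int.natCast_dvd_natCast.1 ⟨l, by rw [h8, mul_comm]⟩

theorem nodup_leftInvSeq_altList (a b : B) : (cs.leftInvSeq (altList a b (M a b))).Nodup := by
  rw [leftInvSeq_altList]
  refine List.Nodup.map_on (fun k hk l hl h => ?_) List.nodup_range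
  rw [List.mem_range] at hk hl
  have h := mul_right_cancel h
  wlog hkl : k ≤ l generalizing k l
  · exact (this l hl k hk (h ▸ rfl) h.symm (by omega)).symm
  obtain ⟨d, rfl⟩ := Nat.exists_eq_add_of_le hkl
  rw [pow_add, left_eq_mul] at h
  have := Nat.eq_zero_of_dvd_of_lt (cs.dvd_of_simple_mul_simple_pow_eq_one h) (by omega)
  omega

end CoxeterSystem

theorem map_altList {B C : Type*} (f : B → C) (a b : B) (n : ℕ) :
    (altList a b n).map f = altList (f a) (f b) n := by
  induction n generalizing a b with
  | zero => rfl
  | succ n ih => simp [altList, ih]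

/-! ### Parabolic subgroups, minimal coset representatives and Deodhar's lemma -/

namespace CoxeterSystem

variable {B W : Type*} [Group W] {M : CoxeterMatrix B} (cs : CoxeterSystem M W)

/-- The standard parabolic subgroup generated by the simple reflections indexed by `X`. -/
def parabolic (X : Set B) : Subgroup W := Subgroup.closure (cs.simple '' X)

theorem simple_mem_parabolic {X : Set B} {i : B} (hi : i ∈ X) : cs.simple i ∈ cs.parabolic X :=
  Subgroup.subset_closure ⟨i, hi, rfl⟩

theorem wordProd_mem_parabolic {X : Set B} {ω : List B} (hω : ∀ i ∈ ω, i ∈ X) :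
    cs.wordProd ω ∈ cs.parabolic X :=
  Subgroup.list_prod_mem _ fun w hw => by
    obtain ⟨i, hi, rfl⟩ := List.mem_map.1 hw
    exact cs.simple_mem_parabolic (hω i hi)

theorem parabolic_mono {X Y : Set B} (h : X ⊆ Y) : cs.parabolic X ≤ cs.parabolic Y :=
  Subgroup.closure_mono (Set.image_mono h)

theorem exists_word_of_mem_parabolic {X : Set B} {v : W} (hv : v ∈ cs.parabolic X) :
    ∃ ω : List B, (∀ i ∈ ω, i ∈ X) ∧ cs.wordProd ω = v := by
  induction hv using Subgroup.closure_induction with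
  | mem w hw =>
    obtain ⟨i, hi, rfl⟩ := hw
    exact ⟨[i], by simpa using hi, by simp⟩
  | one => exact ⟨[], by simp, by simp⟩
  | mul v w _ _ hv hw =>
    obtain ⟨ω, h, rfl⟩ := hv
    obtain ⟨ω', h', rfl⟩ := hw
    refine ⟨ω ++ ω', fun i hi => ?_, by simp [wordProd_append]⟩
    rcases List.mem_append.1 hi with hi | hi
    exacts [h i hi, h' i hi]
  | inv v _ hv =>
    obtain ⟨ω, h, rfl⟩ := hv
    exact ⟨ω.reverse, by simpa using h, by simp⟩

/-- `w` has minimal length in its right coset by the parabolic subgroup of `X`. -/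
def IsCosetMin (X : Set B) (w : W) : Prop :=
  ∀ v ∈ cs.parabolic X, cs.length w ≤ cs.length (v * w)

theorem isCosetMin_one (X : Set B) : cs.IsCosetMin X 1 := fun _ _ => by simp

theorem exists_isCosetMin (X : Set B) (u : W) :
    ∃ v ∈ cs.parabolic X, ∃ w, cs.IsCosetMin X w ∧ u = v * w := by
  obtain ⟨_, ⟨v, rfl⟩, hv⟩ := wellFounded_lt.has_min
    (Set.range fun v : cs.parabolic X => cs.length ((v : W) * u)) ⟨_, 1, rfl⟩
  refine ⟨(v : W)⁻¹, inv_mem v.2, v * u, fun a ha => ?_, by group⟩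
  have := hv _ ⟨⟨a, ha⟩ * v, rfl⟩
  simpa [mul_assoc] using this

/-- If a new first letter shortened the product, the exchange property would delete a letter of ω,
against `hmin`, or one of a reduced word for w, against minimality. The word is only assumed
shortest among words in X; the case w = 1 then shows that it is reduced in W. -/
theorem length_wordProd_mul_of_isCosetMin {X : Set B} {w : W} (hw : cs.IsCosetMin X w)
    {ω : List B} (hω : ∀ i ∈ ω, i ∈ X)
    (hmin : ∀ ω' : List B, (∀ i ∈ ω', i ∈ X) → cs.wordProd ω' = cs.wordProd ω →
      ω.length ≤ ω'.length) :
    cs.length (cs.wordProd ω * w) = ω.length + cs.length w := by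
  induction ω with
  | nil => simp
  | cons t ω ih =>
    have ht : t ∈ X := hω t (by simp)
    have hω' : ∀ i ∈ ω, i ∈ X := fun i hi => hω i (by simp [hi])
    specialize ih hω' fun ω' h h' => by
      have := hmin (t :: ω') (by simpa [ht] using h) (by simp [wordProd_cons, h'])
      simpa using this
    rw [wordProd_cons, mul_assoc, List.length_cons]
    rcases cs.length_simple_mul (cs.wordProd ω * w) t with h | h
    · rw [h, ih]
      ring
    exfalso
    obtain ⟨ρ, hρ, rfl⟩ := cs.exists_isReduced w
    rw [← wordProd_append] at h
    obtain ⟨j, hj, he⟩ := IsLeftDescent.exists_eraseIdx (cs.isLeftDescent_iff.2 h)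
    rcases lt_or_ge j ω.length with hjω | hjω
    · rw [List.eraseIdx_append_of_lt_length hjω, wordProd_append, wordProd_append, ← mul_assoc]
        at he
      have := hmin (ω.eraseIdx j) (fun i hi => hω' i (List.mem_of_mem_eraseIdx hi))
        (by rw [wordProd_cons, mul_right_cancel he])
      have := List.length_eraseIdx_add_one hjω
      simp at *
      omega
    · rw [List.eraseIdx_append_of_length_le hjω, wordProd_append, wordProd_append] at he
      have h1 := hw ((cs.wordProd ω)⁻¹ * (cs.simple t * cs.wordProd ω))
        (mul_mem (inv_mem (cs.wordProd_mem_parabolic hω'))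
          (mul_mem (cs.simple_mem_parabolic ht) (cs.wordProd_mem_parabolic hω')))
      rw [mul_assoc, mul_assoc, he, inv_mul_cancel_left, hρ.eq] at h1
      have h2 := cs.length_wordProd_le (ρ.eraseIdx (j - ω.length))
      rw [List.length_append] at hj
      have := List.length_eraseIdx_add_one (l := ρ) (i := j - ω.length) (by omega)
      omega

theorem exists_shortest_word_of_mem_parabolic {X : Set B} {v : W} (hv : v ∈ cs.parabolic X) :
    ∃ ω : List B, (∀ i ∈ ω, i ∈ X) ∧ cs.wordProd ω = v ∧
      ∀ ω' : List B, (∀ i ∈ ω', i ∈ X) → cs.wordProd ω' = cs.wordProd ω →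
        ω.length ≤ ω'.length := by
  obtain ⟨ω₀, h₀, hp₀⟩ := cs.exists_word_of_mem_parabolic hv
  obtain ⟨ω, ⟨h, hp⟩, hmin⟩ := (measure (List.length (α := B))).wf.has_min
    {ω | (∀ i ∈ ω, i ∈ X) ∧ cs.wordProd ω = v} ⟨ω₀, h₀, hp₀⟩
  exact ⟨ω, h, hp, fun ω' h' hp' => not_lt.1 (hmin ω' ⟨h', hp'.trans hp⟩)⟩

theorem exists_isReduced_of_mem_parabolic {X : Set B} {v : W} (hv : v ∈ cs.parabolic X) :
    ∃ ω : List B, (∀ i ∈ ω, i ∈ X) ∧ cs.IsReduced ω ∧ cs.wordProd ω = v := by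
  obtain ⟨ω, h, hp, hmin⟩ := cs.exists_shortest_word_of_mem_parabolic hv
  refine ⟨ω, h, ?_, hp⟩
  simpa [IsReduced] using cs.length_wordProd_mul_of_isCosetMin (cs.isCosetMin_one X) h hmin

theorem IsCosetMin.length_mul {cs : CoxeterSystem M W} {X : Set B} {v w : W}
    (hw : cs.IsCosetMin X w) (hv : v ∈ cs.parabolic X) :
    cs.length (v * w) = cs.length v + cs.length w := by
  obtain ⟨ω, h, rfl, hmin⟩ := cs.exists_shortest_word_of_mem_parabolic hv
  have h1 := cs.length_wordProd_mul_of_isCosetMin (cs.isCosetMin_one X) h hmin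
  rw [mul_one, length_one, add_zero] at h1
  rw [cs.length_wordProd_mul_of_isCosetMin hw h hmin, h1]

/-- Additivity of lengths and minimality of w' force v'⁻¹v to have length 0. -/
theorem IsCosetMin.eq_of_mul_eq {cs : CoxeterSystem M W} {X : Set B} {v w v' w' : W}
    (hw : cs.IsCosetMin X w) (hw' : cs.IsCosetMin X w') (hv : v ∈ cs.parabolic X)
    (hv' : v' ∈ cs.parabolic X) (h : v * w = v' * w') : w = w' := by
  have h1 : w' = v'⁻¹ * v * w := by rw [mul_assoc, h, inv_mul_cancel_left]
  have hu : v'⁻¹ * v ∈ cs.parabolic X := mul_mem (inv_mem hv') hv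
  have h2 := hw.length_mul hu
  have h3 := hw' _ (inv_mem hu)
  rw [← h1] at h2
  rw [h1, inv_mul_cancel_left, ← h1] at h3
  have h4 : v'⁻¹ * v = 1 := cs.length_eq_zero_iff.1 (by omega)
  rw [h1, h4, one_mul]

theorem isCosetMin_of_forall_not_isLeftDescent {X : Set B} {w : W}
    (h : ∀ t ∈ X, ¬ cs.IsLeftDescent w t) : cs.IsCosetMin X w := by
  obtain ⟨v, hv, w₀, hw₀, rfl⟩ := cs.exists_isCosetMin X w
  obtain ⟨ω, hω, hred, rfl⟩ := cs.exists_isReduced_of_mem_parabolic hv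
  cases ω with
  | nil => simpa using hw₀
  | cons t ω =>
    refine absurd ?_ (h t (hω t (by simp)))
    rw [IsLeftDescent, hw₀.length_mul hv, hred.eq, wordProd_cons, mul_assoc,
      simple_mul_simple_cancel_left]
    have := cs.length_mul_le (cs.wordProd ω) w₀
    have := cs.length_wordProd_le ω
    simp only [List.length_cons]
    omega

/-- Deodhar's lemma. -/
theorem IsCosetMin.mul_simple {cs : CoxeterSystem M W} {X : Set B} {w : W}
    (hw : cs.IsCosetMin X w) (z : B) :
    cs.IsCosetMin X (w * cs.simple z) ∨ ∃ t ∈ X, w * cs.simple z * w⁻¹ = cs.simple t := by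
  by_contra! hcon
  obtain ⟨h, h'⟩ := hcon
  refine h (cs.isCosetMin_of_forall_not_isLeftDescent fun t ht hd => ?_)
  obtain ⟨ρ, hρ, rfl⟩ := cs.exists_isReduced w
  rw [← wordProd_concat] at hd
  obtain ⟨j, hj, he⟩ := hd.exists_eraseIdx
  simp only [List.concat_eq_append] at hj he
  -- The exchanged letter lies in ρ, and then s_t w is shorter than w, or it is the final z, and
  -- then s_t w s_z = w.
  rcases lt_or_ge j ρ.length with hjρ | hjρ
  · rw [List.eraseIdx_append_of_lt_length hjρ, wordProd_append, wordProd_append, ← mul_assoc] at he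
    have h1 := hw _ (cs.simple_mem_parabolic ht)
    rw [mul_right_cancel he, hρ.eq] at h1
    have h2 := cs.length_wordProd_le (ρ.eraseIdx j)
    have := List.length_eraseIdx_add_one hjρ
    omega
  · rw [List.eraseIdx_append_of_length_le hjρ, wordProd_append, wordProd_append] at he
    simp only [List.length_append, List.length_singleton] at hj
    have hj0 : j - ρ.length = 0 := by omega
    rw [hj0] at he
    simp only [wordProd_singleton, List.eraseIdx_cons_zero, wordProd_nil, mul_one] at he
    refine h' t ht ?_
    rw [mul_inv_eq_iff_eq_mul, eq_comm, ← cs.inv_simple t, inv_mul_eq_iff_eq_mul]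
    exact he.symm

/-! ### Matsumoto's theorem -/

theorem IsReduced.of_cons {cs : CoxeterSystem M W} {i : B} {ω : List B}
    (h : cs.IsReduced (i :: ω)) : cs.IsReduced ω := h.drop 1

theorem IsReduced.eq_altList {cs : CoxeterSystem M W} {a b : B} {ω : List B}
    (h : cs.IsReduced (a :: ω)) (hω : ∀ i ∈ ω, i = a ∨ i = b) :
    a :: ω = altList a b (ω.length + 1) := by
  induction ω generalizing a b with
  | nil => rfl
  | cons c ω ih =>
    have hc : c ≠ a := by
      rintro rfl
      have h1 := h.eq
      rw [wordProd_cons, wordProd_cons, simple_mul_simple_cancel_left] at h1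
      have := cs.length_wordProd_le ω
      simp only [List.length_cons] at h1
      omega
    obtain rfl : c = b := (hω c (by simp)).resolve_left hc
    rw [ih h.of_cons fun i hi => (hω i (by simp [hi])).symm]
    simp [altList]

theorem exists_altList_of_isLeftDescent {a b : B} {v : W} (hv : v ∈ cs.parabolic {a, b})
    (ha : cs.IsLeftDescent v a) : cs.wordProd (altList a b (cs.length v)) = v := by
  obtain ⟨σ, hσ, hred, hp⟩ := cs.exists_isReduced_of_mem_parabolic
    (mul_mem (cs.simple_mem_parabolic (X := {a, b}) (by simp : a ∈ _)) hv)
  have hp' : cs.wordProd (a :: σ) = v := by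
    rw [wordProd_cons, hp, simple_mul_simple_cancel_left]
  have hlen : cs.length v = σ.length + 1 := by
    rw [← cs.isLeftDescent_iff.1 ha, ← hp, hred.eq]
  have hred' : cs.IsReduced (a :: σ) := by
    rw [IsReduced, hp', hlen, List.length_cons]
  rw [hlen, ← hred'.eq_altList (by simpa using hσ), hp']

/-- Such a v has two alternating words of length ℓ, so (s_a s_b)^ℓ = 1 and m divides ℓ. If ℓ > m,
the inversions at positions 0 and m would coincide. -/
theorem length_eq_of_isLeftDescent {a b : B} {v : W} (hv : v ∈ cs.parabolic {a, b})
    (ha : cs.IsLeftDescent v a) (hb : cs.IsLeftDescent v b) :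
    cs.length v = M a b ∧ M a b ≠ 0 := by
  have h1 := cs.exists_altList_of_isLeftDescent hv ha
  have h2 := cs.exists_altList_of_isLeftDescent (Set.pair_comm a b ▸ hv) hb
  have hpos : cs.length v ≠ 0 := by
    rw [IsLeftDescent] at ha
    omega
  have hred : cs.IsReduced (altList a b (cs.length v)) := by rw [IsReduced, h1, length_altList]
  have hdvd : M a b ∣ cs.length v := by
    refine cs.dvd_of_simple_mul_simple_pow_eq_one ?_
    rw [← altProd_mul_inv_altProd (cs.simple_mul_simple_self a) (cs.simple_mul_simple_self b),
      ← prod_map_altList, ← prod_map_altList]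
    change cs.wordProd _ * (cs.wordProd _)⁻¹ = 1
    rw [h1, h2, mul_inv_cancel]
  have hM : M a b ≠ 0 := by
    intro h
    rw [h] at hdvd
    exact hpos (Nat.eq_zero_of_zero_dvd hdvd)
  refine ⟨le_antisymm ?_ (Nat.le_of_dvd (by omega) hdvd), hM⟩
  by_contra! hlt
  have hnd := hred.nodup_leftInvSeq
  rw [leftInvSeq_altList, List.nodup_map_iff_inj_on List.nodup_range] at hnd
  exact hM (hnd (M a b) (by simpa using hlt) 0 (by simp; omega) (by simp))

/-- Matsumoto's theorem for words in a parabolic subgroup: reduced words that represent the same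
element have the same image in every monoid in which the braid relations hold. -/
theorem prod_map_eq_of_isReduced {C G : Type*} [Monoid G] (ι : C → B) (f : C → G)
    (hf : ∀ a b : C, M (ι a) (ι b) ≠ 0 →
      altProd (f a) (f b) (M (ι a) (ι b)) = altProd (f b) (f a) (M (ι a) (ι b)))
    {ω ω' : List C} (hω : cs.IsReduced (ω.map ι)) (hω' : cs.IsReduced (ω'.map ι))
    (h : cs.wordProd (ω.map ι) = cs.wordProd (ω'.map ι)) :
    (ω.map f).prod = (ω'.map f).prod := by
  induction hn : ω.length generalizing ω ω' with
  | zero =>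
    have h1 := hω.eq
    rw [h, hω'.eq, List.length_map, List.length_map, hn, List.length_eq_zero_iff] at h1
    rw [h1, List.length_eq_zero_iff.1 hn]
  | succ n ih =>
    have hlen : ω'.length = n + 1 := by
      rw [← hn, ← List.length_map (as := ω') ι, ← hω'.eq, ← h, hω.eq, List.length_map]
    obtain ⟨a, ω₁, rfl⟩ := List.exists_cons_of_length_eq_add_one hn
    obtain ⟨b, ω₁', rfl⟩ := List.exists_cons_of_length_eq_add_one hlen
    -- Words with the same first letter reduce to shorter ones; the rest of the proof links the
    -- first letters a and b.
    have same : ∀ (c : C) (ρ ρ' : List C), cs.IsReduced ((c :: ρ).map ι) →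
        cs.IsReduced ((c :: ρ').map ι) →
        cs.wordProd ((c :: ρ).map ι) = cs.wordProd ((c :: ρ').map ι) → ρ.length = n →
        ((c :: ρ).map f).prod = ((c :: ρ').map f).prod := by
      intro c ρ ρ' hρ hρ' hp hl
      simp only [List.map_cons, List.prod_cons, wordProd_cons] at hρ hρ' hp ⊢
      rw [ih hρ.of_cons hρ'.of_cons (mul_left_cancel hp) hl]
    set w := cs.wordProd ((a :: ω₁).map ι) with hw
    have hdesc : ∀ (c : C) (ρ : List C), cs.IsReduced ((c :: ρ).map ι) →
        cs.IsLeftDescent (cs.wordProd ((c :: ρ).map ι)) (ι c) := by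
      intro c ρ hρ
      rw [IsLeftDescent, hρ.eq]
      have := cs.length_wordProd_le (ρ.map ι)
      simp only [List.map_cons, wordProd_cons, simple_mul_simple_cancel_left, List.length_cons]
      omega
    have hda := hdesc a ω₁ hω
    have hdb := hdesc b ω₁' hω'
    rw [← h] at hdb
    rw [← hw] at hda
    -- Both descents of w pass to the dihedral factor v, which therefore has length m and two
    -- alternating words.
    obtain ⟨v, hv, w₀, hw₀, hvw⟩ := cs.exists_isCosetMin {ι a, ι b} w
    have hmem : ∀ c ∈ ({ι a, ι b} : Set B), cs.IsLeftDescent w c → cs.IsLeftDescent v c := by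
      intro c hc hd
      rw [IsLeftDescent, hvw, ← mul_assoc, hw₀.length_mul hv,
        hw₀.length_mul (mul_mem (cs.simple_mem_parabolic hc) hv)] at hd
      rw [IsLeftDescent]
      omega
    have hva := hmem (ι a) (by simp) hda
    have hvb := hmem (ι b) (by simp) hdb
    obtain ⟨hlv, hM⟩ := cs.length_eq_of_isLeftDescent hv hva hvb
    have h1 := cs.exists_altList_of_isLeftDescent hv hva
    have h2 := cs.exists_altList_of_isLeftDescent (Set.pair_comm (ι a) (ι b) ▸ hv) hvb
    have hsub : ({ι a, ι b} : Set B) ⊆ Set.range ι := by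
      rintro _ (rfl | rfl) <;> exact ⟨_, rfl⟩
    have hwX : w ∈ cs.parabolic (Set.range ι) := cs.wordProd_mem_parabolic fun i hi => by
      obtain ⟨c, -, rfl⟩ := List.mem_map.1 hi
      exact ⟨c, rfl⟩
    have hw₀X : w₀ ∈ cs.parabolic (Set.range ι) := by
      have : w₀ = v⁻¹ * w := by rw [hvw, inv_mul_cancel_left]
      rw [this]
      exact mul_mem (inv_mem (cs.parabolic_mono hsub hv)) hwX
    obtain ⟨τ, hτ, hτred, hτp⟩ := cs.exists_isReduced_of_mem_parabolic hw₀X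
    obtain ⟨τ, rfl⟩ : τ ∈ Set.range (List.map ι) := by rwa [Set.range_list_map]
    have hlw : cs.length w = n + 1 := by rw [hω.eq, List.length_map, hn]
    obtain ⟨k, hk⟩ : ∃ k, M (ι a) (ι b) = k + 1 := Nat.exists_eq_succ_of_ne_zero hM
    have hlτ : k + τ.length = n := by
      have := hw₀.length_mul hv
      rw [← hvw, hlw, hlv, hk, ← hτp, hτred.eq, List.length_map] at this
      omega
    -- Followed by a fixed word τ for w₀, the two alternating words of v give reduced words for w
    -- that start with a and b and differ by one braid relation.
    have hA : ∀ c d : C, cs.wordProd (altList (ι c) (ι d) (cs.length v)) = v →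
        cs.wordProd ((c :: (altList d c k ++ τ)).map ι) = w ∧
        cs.IsReduced ((c :: (altList d c k ++ τ)).map ι) := by
      intro c d hcd
      have hp : cs.wordProd ((c :: (altList d c k ++ τ)).map ι) = w := by
        rw [← List.cons_append, List.map_append, wordProd_append, hτp, hvw]
        congr 1
        rw [← hcd, hlv, hk, ← map_altList]
        rfl
      refine ⟨hp, ?_⟩
      rw [IsReduced, hp, hlw]
      simp
      omega
    obtain ⟨pa, ra⟩ := hA a b h1
    obtain ⟨pb, rb⟩ := hA b a h2
    rw [same a ω₁ _ hω ra pa.symm (by simpa using hn),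
      same b ω₁' _ hω' rb (by rw [pb, ← h]) (by simpa using hlen)]
    have hbraid := hf a b hM
    rw [hk, ← prod_map_altList, ← prod_map_altList] at hbraid
    rw [← List.cons_append, ← List.cons_append, List.map_append, List.map_append,
      List.prod_append, List.prod_append]
    exact congrArg (· * (τ.map f).prod) hbraid

end CoxeterSystem

/-! ### Words in Artin groups and the retraction onto a parabolic subgroup -/

noncomputable section

/-- The action of a group on itself by right translations. -/
def rightPerm (W : Type*) [Group W] : W →* Equiv.Perm W where
  toFun w := Equiv.mulRight w⁻¹
  map_one' := by ext; simp
  map_mul' w w' := by ext; simp [mul_assoc]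

theorem rightPerm_inv_apply {W : Type*} [Group W] (w u : W) : (rightPerm W w)⁻¹ u = u * w := by
  rw [← map_inv]
  simp [rightPerm]

namespace LabeledGraph

variable {V : Type*} (Γ : LabeledGraph V) (X : Set V)

theorem altProd_artinGen {x y : V} (h : Γ.graph.Adj x y) :
    altProd (Γ.artinGen x) (Γ.artinGen y) (Γ.label ⟨s(x, y), h⟩) =
      altProd (Γ.artinGen y) (Γ.artinGen x) (Γ.label ⟨s(x, y), h⟩) := by
  have := PresentedGroup.one_of_mem (rels := Γ.artinRels) ⟨x, y, h, rfl⟩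
  rw [map_mul, map_inv, map_altProd, map_altProd] at this
  exact mul_inv_eq_one.1 this

theorem artinWord_append (α β : List (V × Bool)) :
    Γ.artinWord (α ++ β) = Γ.artinWord α * Γ.artinWord β := by
  simp [artinWord]

theorem artinWord_surjective : Function.Surjective Γ.artinWord := by
  classical
  intro a
  obtain ⟨g, rfl⟩ := PresentedGroup.mk_surjective _ a
  refine ⟨g.toWord, ?_⟩
  conv_rhs => rw [← FreeGroup.mk_toWord (x := g)]
  induction g.toWord with
  | nil => rfl
  | cons l α ih =>
    rw [← List.singleton_append, artinWord_append, ih, ← FreeGroup.mul_mk, map_mul]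
    congr 1
    obtain ⟨z, _ | _⟩ := l <;> simp [artinWord, artinGen, PresentedGroup.of] <;> rfl

/-! ### The natural map `A[Γ_X] → A` -/

/-- The homomorphism `A[Γ_X] → A` that sends each standard generator to itself. -/
def artinInclusion : (Γ.induce X).ArtinGroup →* Γ.ArtinGroup :=
  PresentedGroup.toGroup (f := fun x : X => Γ.artinGen x) <| by
    rintro _ ⟨x, y, h, rfl⟩
    rw [map_mul, map_inv, map_altProd, map_altProd, FreeGroup.lift_apply_of,
      FreeGroup.lift_apply_of, mul_inv_eq_one]
    exact Γ.altProd_artinGen (x := x) (y := y) h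

theorem artinInclusion_artinGen (x : X) :
    Γ.artinInclusion X ((Γ.induce X).artinGen x) = Γ.artinGen x :=
  PresentedGroup.toGroup.of _

theorem artinInclusion_artinWord (τ : List (X × Bool)) :
    Γ.artinInclusion X ((Γ.induce X).artinWord τ) = Γ.artinWord (includeWord X τ) := by
  rw [artinWord, artinWord, map_list_prod, includeWord, List.map_map, List.map_map]
  congr 1
  refine List.map_congr_left fun l _ => ?_
  obtain ⟨z, _ | _⟩ := l <;> simp [artinInclusion_artinGen]

theorem artinInclusion_mem (a : (Γ.induce X).ArtinGroup) :
    Γ.artinInclusion X a ∈ Γ.artinParabolic X := by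
  obtain ⟨τ, rfl⟩ := artinWord_surjective _ a
  rw [artinWord, map_list_prod]
  refine Subgroup.list_prod_mem _ fun g hg => ?_
  obtain ⟨_, hl, rfl⟩ := List.mem_map.1 hg
  obtain ⟨⟨z, ε⟩, -, rfl⟩ := List.mem_map.1 hl
  have hz : Γ.artinGen z ∈ Γ.artinParabolic X := Subgroup.subset_closure ⟨z, z.2, rfl⟩
  cases ε
  · simpa [artinInclusion_artinGen] using hz
  · simpa [artinInclusion_artinGen] using hz

/-! ### Minimal coset representatives -/

theorem isCosetMin_minimalPart (u : Γ.CoxeterGroup) :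
    Γ.coxeterSystem.IsCosetMin X (Γ.minimalPart X u) := fun v hv =>
  (Γ.minimalPart_spec X u).1 _
    (DoubleCoset.mem_doubleCoset.2 ⟨v, hv, 1, one_mem _, (mul_one _).symm⟩)

/-- The factor in `W_X` of the decomposition `u = v * w` with `w` minimal. -/
def parabolicPart (u : Γ.CoxeterGroup) : Γ.CoxeterGroup := u * (Γ.minimalPart X u)⁻¹

theorem parabolicPart_mem (u : Γ.CoxeterGroup) :
    Γ.parabolicPart X u ∈ Γ.coxeterSystem.parabolic X := by
  obtain ⟨v, hv, h⟩ := (Γ.minimalPart_spec X u).2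
  rw [parabolicPart, ← eq_mul_inv_of_mul_eq h.symm]
  exact hv

theorem parabolicPart_mul_minimalPart (u : Γ.CoxeterGroup) :
    Γ.parabolicPart X u * Γ.minimalPart X u = u := inv_mul_cancel_right _ _

variable {X} in
theorem minimalPart_eq {v w : Γ.CoxeterGroup} (hv : v ∈ Γ.coxeterSystem.parabolic X)
    (hw : Γ.coxeterSystem.IsCosetMin X w) : Γ.minimalPart X (v * w) = w :=
  ((Γ.isCosetMin_minimalPart X _).eq_of_mul_eq hw (Γ.parabolicPart_mem X _) hv
    (Γ.parabolicPart_mul_minimalPart X _))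

/-! ### The output of positive words -/

/-- The minimal element by which `piHatLetter` conjugates. -/
abbrev letterBase (u : Γ.CoxeterGroup) (z : V) (ε : Bool) : Γ.CoxeterGroup :=
  if ε then Γ.minimalPart X u else Γ.minimalPart X (u * Γ.coxeterGen z)

theorem piHatLetter_eq {u : Γ.CoxeterGroup} {z : V} {ε : Bool} {x : X}
    (h : Γ.letterBase X u z ε * Γ.coxeterGen z * (Γ.letterBase X u z ε)⁻¹ = Γ.coxeterGen x) :
    Γ.piHatLetter X u z ε = [(x, ε)] := by
  have hex : ∃ x : X, Γ.letterBase X u z ε * Γ.coxeterGen z * (Γ.letterBase X u z ε)⁻¹ =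
      Γ.coxeterGen x := ⟨x, h⟩
  have hx : hex.choose = x := Subtype.ext
    (Γ.coxeterSystem.simple_injective (hex.choose_spec.symm.trans h))
  rw [piHatLetter, dif_pos hex, hx]

theorem piHatLetter_eq_nil {u : Γ.CoxeterGroup} {z : V} {ε : Bool}
    (h : ¬ ∃ x : X, Γ.letterBase X u z ε * Γ.coxeterGen z * (Γ.letterBase X u z ε)⁻¹ =
      Γ.coxeterGen x) :
    Γ.piHatLetter X u z ε = [] := by
  rw [piHatLetter, dif_neg h]

/-- Both letters are conjugated by the minimal part of u s_z; this is why negative letters use w_i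
in place of w_{i-1}. -/
theorem artinWord_piHatLetter_false (u : Γ.CoxeterGroup) (z : V) :
    (Γ.induce X).artinWord (Γ.piHatLetter X u z false) =
      ((Γ.induce X).artinWord (Γ.piHatLetter X (u * Γ.coxeterGen z) z true))⁻¹ := by
  by_cases h : ∃ x : X, Γ.letterBase X u z false * Γ.coxeterGen z *
      (Γ.letterBase X u z false)⁻¹ = Γ.coxeterGen x
  · obtain ⟨x, hx⟩ := h
    rw [Γ.piHatLetter_eq X hx, Γ.piHatLetter_eq X (u := u * Γ.coxeterGen z) (ε := true) hx]
    simp [artinWord]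
  · rw [Γ.piHatLetter_eq_nil X h,
      Γ.piHatLetter_eq_nil X (u := u * Γ.coxeterGen z) (ε := true) h]
    simp [artinWord]

/-- The vertices of the letters that `piHat` puts out when it reads a positive letter. -/
def outLetter (u : Γ.CoxeterGroup) (z : V) : List X := (Γ.piHatLetter X u z true).map Prod.fst

/-- The vertices of the letters that `piHat` puts out when it reads a positive word. -/
def outWord : Γ.CoxeterGroup → List V → List X
  | _, [] => []
  | u, z :: ω => Γ.outLetter X u z ++ outWord (u * Γ.coxeterGen z) ω

/-- Deodhar's lemma applied to the minimal part of u, with uniqueness of the decomposition to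
identify the parts of u s_z. -/
theorem outLetter_cases (u : Γ.CoxeterGroup) (z : V) :
    (∃ x : X, Γ.minimalPart X u * Γ.coxeterGen z * (Γ.minimalPart X u)⁻¹ = Γ.coxeterGen x ∧
      Γ.outLetter X u z = [x] ∧
      Γ.parabolicPart X (u * Γ.coxeterGen z) = Γ.parabolicPart X u * Γ.coxeterGen x) ∨
    Γ.outLetter X u z = [] ∧
      Γ.parabolicPart X (u * Γ.coxeterGen z) = Γ.parabolicPart X u := by
  by_cases hex : ∃ x : X,
      Γ.minimalPart X u * Γ.coxeterGen z * (Γ.minimalPart X u)⁻¹ = Γ.coxeterGen x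
  · obtain ⟨x, hx⟩ := hex
    refine Or.inl ⟨x, hx, ?_, ?_⟩
    · rw [outLetter, Γ.piHatLetter_eq X (x := x) (ε := true) hx]
      rfl
    · have h1 : u * Γ.coxeterGen z =
          Γ.parabolicPart X u * Γ.coxeterGen x * Γ.minimalPart X u := by
        rw [← hx, parabolicPart]
        group
      have h2 : Γ.minimalPart X (u * Γ.coxeterGen z) = Γ.minimalPart X u := by
        rw [h1]
        exact Γ.minimalPart_eq (mul_mem (Γ.parabolicPart_mem X u)
          (Γ.coxeterSystem.simple_mem_parabolic x.2)) (Γ.isCosetMin_minimalPart X u)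
      rw [parabolicPart, h2, h1, mul_inv_cancel_right]
  · refine Or.inr ⟨?_, ?_⟩
    · rw [outLetter, Γ.piHatLetter_eq_nil X (ε := true) hex]
      rfl
    · have hmin := ((Γ.isCosetMin_minimalPart X u).mul_simple z).resolve_right
        fun ⟨t, ht, h⟩ => hex ⟨⟨t, ht⟩, h⟩
      have h1 : u * Γ.coxeterGen z =
          Γ.parabolicPart X u * (Γ.minimalPart X u * Γ.coxeterGen z) := by
        rw [parabolicPart]
        group
      have h2 : Γ.minimalPart X (u * Γ.coxeterGen z) = Γ.minimalPart X u * Γ.coxeterGen z := by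
        conv_lhs => rw [h1]
        exact Γ.minimalPart_eq (Γ.parabolicPart_mem X u) hmin
      conv_lhs => rw [parabolicPart, h2, h1]
      exact mul_inv_cancel_right _ _

theorem wordProd_outWord (u : Γ.CoxeterGroup) (ω : List V) :
    Γ.coxeterSystem.wordProd ((Γ.outWord X u ω).map Subtype.val) =
      (Γ.parabolicPart X u)⁻¹ * Γ.parabolicPart X (u * Γ.coxeterSystem.wordProd ω) := by
  induction ω generalizing u with
  | nil => simp [outWord]
  | cons z ω ih =>
    rw [outWord, List.map_append, CoxeterSystem.wordProd_append, ih,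
      CoxeterSystem.wordProd_cons, ← mul_assoc u]
    rcases Γ.outLetter_cases X u z with ⟨x, -, ho, hp⟩ | ⟨ho, hp⟩ <;>
      rw [ho, hp] <;> simp [-CoxeterMatrix.toCoxeterSystem_simple, mul_assoc]

/-- If u = vw and w s_z w⁻¹ = s_x, then v s_x v⁻¹ = u s_z u⁻¹: each letter put out crosses the same
reflection as the letter read. -/
theorem leftInvSeq_outWord_sublist (u : Γ.CoxeterGroup) (ω : List V) :
    ((Γ.coxeterSystem.leftInvSeq ((Γ.outWord X u ω).map Subtype.val)).map
      (MulAut.conj (Γ.parabolicPart X u))).Sublist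
      ((Γ.coxeterSystem.leftInvSeq ω).map (MulAut.conj u)) := by
  induction ω generalizing u with
  | nil => simp [outWord]
  | cons z ω ih =>
    have hc : ∀ (a b : Γ.CoxeterGroup) (l : List Γ.CoxeterGroup),
        (l.map (MulAut.conj b)).map (MulAut.conj a) = l.map (MulAut.conj (a * b)) := by
      intro a b l
      rw [List.map_map, map_mul]
      rfl
    specialize ih (u * Γ.coxeterGen z)
    rw [CoxeterSystem.leftInvSeq, List.map_cons, hc, outWord]
    rcases Γ.outLetter_cases X u z with ⟨x, hx, ho, hp⟩ | ⟨ho, hp⟩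
    · rw [hp] at ih
      rw [ho, List.singleton_append, List.map_cons, CoxeterSystem.leftInvSeq, List.map_cons, hc]
      have : MulAut.conj (Γ.parabolicPart X u) (Γ.coxeterGen x) =
          MulAut.conj u (Γ.coxeterGen z) := by
        rw [MulAut.conj_apply, MulAut.conj_apply, ← hx, parabolicPart]
        group
      rw [this]
      exact ih.cons_cons _
    · rw [hp] at ih
      rw [ho, List.nil_append]
      exact ih.cons _

theorem isReduced_outWord (u : Γ.CoxeterGroup) {ω : List V}
    (hω : (Γ.coxeterSystem.leftInvSeq ω).Nodup) :
    Γ.coxeterSystem.IsReduced ((Γ.outWord X u ω).map Subtype.val) :=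
  Γ.coxeterSystem.isReduced_of_nodup_leftInvSeq
    (((hω.map (MulAut.conj u).injective).sublist (Γ.leftInvSeq_outWord_sublist X u ω)).of_map _)

theorem altProd_artinGen_coxeterMatrix {x y : V} (h : Γ.coxeterMatrix x y ≠ 0) :
    altProd (Γ.artinGen x) (Γ.artinGen y) (Γ.coxeterMatrix x y) =
      altProd (Γ.artinGen y) (Γ.artinGen x) (Γ.coxeterMatrix x y) := by
  rcases eq_or_ne x y with rfl | hxy
  · rfl
  by_cases hadj : Γ.graph.Adj x y
  · rw [Γ.coxeterMatrix_of_adj hadj]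
    exact Γ.altProd_artinGen hadj
  · exact absurd (by simp [coxeterMatrix, hxy, hadj]) h

theorem coxeterMatrix_induce (x y : X) :
    (Γ.induce X).coxeterMatrix x y = Γ.coxeterMatrix x y := by
  by_cases hxy : x = y
  · simp [hxy]
  by_cases hadj : Γ.graph.Adj x y
  · rw [Γ.coxeterMatrix_of_adj hadj]
    exact (Γ.induce X).coxeterMatrix_of_adj (x := x) (y := y) hadj
  · have h' : ¬ (Γ.induce X).graph.Adj x y := hadj
    simp [coxeterMatrix, hxy, hadj, h', Subtype.val_inj]

theorem prod_outWord_altList (u : Γ.CoxeterGroup) (x y : V) :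
    ((Γ.outWord X u (altList x y (Γ.coxeterMatrix x y))).map (Γ.induce X).artinGen).prod =
      ((Γ.outWord X u (altList y x (Γ.coxeterMatrix x y))).map (Γ.induce X).artinGen).prod := by
  have h2 := Γ.coxeterSystem.nodup_leftInvSeq_altList y x
  rw [Γ.coxeterMatrix.symmetric] at h2
  refine Γ.coxeterSystem.prod_map_eq_of_isReduced Subtype.val (Γ.induce X).artinGen ?_
    (Γ.isReduced_outWord X u (Γ.coxeterSystem.nodup_leftInvSeq_altList x y))
    (Γ.isReduced_outWord X u h2) ?_
  · intro a b
    rw [← coxeterMatrix_induce]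
    exact (Γ.induce X).altProd_artinGen_coxeterMatrix
  · rw [wordProd_outWord, wordProd_outWord]
    congr 3
    rw [CoxeterSystem.wordProd, CoxeterSystem.wordProd, prod_map_altList, prod_map_altList,
      ← mul_inv_eq_one, altProd_mul_inv_altProd (Γ.coxeterSystem.simple_mul_simple_self x)
      (Γ.coxeterSystem.simple_mul_simple_self y)]
    exact Γ.coxeterSystem.simple_mul_simple_pow x y

/-! ### The cocycle on the Artin group -/

/-- The image of a standard generator of `A` in the semidirect product
`(W → A[Γ_X]) ⋊ W`. -/
def stepGen (z : V) : (Γ.CoxeterGroup → (Γ.induce X).ArtinGroup) ⋊[funAut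
    (rightPerm Γ.CoxeterGroup)] Γ.CoxeterGroup :=
  ⟨fun u => ((Γ.outLetter X u z).map (Γ.induce X).artinGen).prod, Γ.coxeterGen z⟩

/-- The action by right translations makes the factor after σ_z be evaluated at u s_z, as in the
recursion of `outWord`. -/
theorem prod_map_stepGen (ω : List V) :
    (ω.map (Γ.stepGen X)).prod =
      ⟨fun u => ((Γ.outWord X u ω).map (Γ.induce X).artinGen).prod,
        Γ.coxeterSystem.wordProd ω⟩ := by
  induction ω with
  | nil => rfl
  | cons z ω ih =>
    rw [List.map_cons, List.prod_cons, ih]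
    refine SemidirectProduct.ext (funext fun u => ?_) ?_
    · simp only [SemidirectProduct.mul_left, Pi.mul_apply, funAut_apply, stepGen, outWord,
        rightPerm_inv_apply, List.map_append, List.prod_append]
    · simp [-CoxeterMatrix.toCoxeterSystem_simple, stepGen, CoxeterSystem.wordProd_cons]

/-- The homomorphism from `A` to `(W → A[Γ_X]) ⋊ W` whose first component records the output of
`piHat` for each starting point in `W`. -/
def stepHom : Γ.ArtinGroup →* (Γ.CoxeterGroup → (Γ.induce X).ArtinGroup) ⋊[funAut
    (rightPerm Γ.CoxeterGroup)] Γ.CoxeterGroup :=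
  PresentedGroup.toGroup (f := Γ.stepGen X) <| by
    rintro _ ⟨x, y, h, rfl⟩
    rw [map_mul, map_inv, map_altProd, map_altProd, FreeGroup.lift_apply_of,
      FreeGroup.lift_apply_of, mul_inv_eq_one, ← prod_map_altList, ← prod_map_altList,
      prod_map_stepGen, prod_map_stepGen, ← Γ.coxeterMatrix_of_adj h]
    refine SemidirectProduct.ext (funext fun u => Γ.prod_outWord_altList X u x y) ?_
    change Γ.coxeterSystem.wordProd _ = Γ.coxeterSystem.wordProd _
    rw [CoxeterSystem.wordProd, CoxeterSystem.wordProd, prod_map_altList, prod_map_altList,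
      ← mul_inv_eq_one, altProd_mul_inv_altProd (Γ.coxeterSystem.simple_mul_simple_self x)
      (Γ.coxeterSystem.simple_mul_simple_self y)]
    exact Γ.coxeterSystem.simple_mul_simple_pow x y

theorem stepHom_artinGen (z : V) : Γ.stepHom X (Γ.artinGen z) = Γ.stepGen X z :=
  PresentedGroup.toGroup.of _

theorem theta_artinGen (z : V) : Γ.theta (Γ.artinGen z) = Γ.coxeterGen z :=
  PresentedGroup.toGroup.of _

theorem stepHom_right (a : Γ.ArtinGroup) : (Γ.stepHom X a).right = Γ.theta a := by
  have : SemidirectProduct.rightHom.comp (Γ.stepHom X) = Γ.theta := by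
    refine PresentedGroup.ext fun z => ?_
    change (Γ.stepHom X (Γ.artinGen z)).right = Γ.theta (Γ.artinGen z)
    rw [stepHom_artinGen, theta_artinGen]
    rfl
  exact DFunLike.congr_fun this a

/-- The element of `A[Γ_X]` that `piHat` puts out for a word that represents `a`, when it starts
at `u`. -/
def output (u : Γ.CoxeterGroup) (a : Γ.ArtinGroup) : (Γ.induce X).ArtinGroup :=
  (Γ.stepHom X a).left u

theorem output_one (u : Γ.CoxeterGroup) : Γ.output X u 1 = 1 := by
  rw [output, map_one]
  rfl

theorem output_mul (u : Γ.CoxeterGroup) (a b : Γ.ArtinGroup) :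
    Γ.output X u (a * b) = Γ.output X u a * Γ.output X (u * Γ.theta a) b := by
  rw [output, map_mul, SemidirectProduct.mul_left, Pi.mul_apply, funAut_apply, stepHom_right,
    rightPerm_inv_apply]
  rfl

theorem output_inv (u : Γ.CoxeterGroup) (a : Γ.ArtinGroup) :
    Γ.output X u a⁻¹ = (Γ.output X (u * (Γ.theta a)⁻¹) a)⁻¹ := by
  have := Γ.output_mul X u a⁻¹ a
  rw [inv_mul_cancel, output_one, map_inv] at this
  exact eq_inv_of_mul_eq_one_left this.symm

theorem output_artinGen (u : Γ.CoxeterGroup) (z : V) :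
    Γ.output X u (Γ.artinGen z) =
      ((Γ.outLetter X u z).map (Γ.induce X).artinGen).prod := by
  rw [output, stepHom_artinGen]
  rfl

theorem artinWord_piHatLetter_true (u : Γ.CoxeterGroup) (z : V) :
    (Γ.induce X).artinWord (Γ.piHatLetter X u z true) = Γ.output X u (Γ.artinGen z) := by
  rw [output_artinGen, outLetter]
  by_cases h : ∃ x : X, Γ.letterBase X u z true * Γ.coxeterGen z *
      (Γ.letterBase X u z true)⁻¹ = Γ.coxeterGen x
  · obtain ⟨x, hx⟩ := h
    rw [Γ.piHatLetter_eq X hx]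
    simp [artinWord]
  · rw [Γ.piHatLetter_eq_nil X h]
    simp [artinWord]

theorem artinWord_piHatFrom (u : Γ.CoxeterGroup) (α : List (V × Bool)) :
    (Γ.induce X).artinWord (Γ.piHatFrom X u α) = Γ.output X u (Γ.artinWord α) := by
  induction α generalizing u with
  | nil => exact (Γ.output_one X u).symm
  | cons l α ih =>
    obtain ⟨z, ε⟩ := l
    rw [← List.singleton_append (l := α), artinWord_append, output_mul, List.singleton_append,
      piHatFrom, artinWord_append, ih]
    cases ε
    · rw [artinWord_piHatLetter_false, artinWord_piHatLetter_true]
      simp [-CoxeterMatrix.toCoxeterSystem_simple, artinWord, output_inv, theta_artinGen]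
    · rw [artinWord_piHatLetter_true]
      simp [artinWord, theta_artinGen]

/-- The image of the output in W records the change of the W_X-part of the tracked point. It is
trivial when θ(a) = 1. -/
theorem theta_artinInclusion_output (u : Γ.CoxeterGroup) (a : Γ.ArtinGroup) :
    Γ.theta (Γ.artinInclusion X (Γ.output X u a)) =
      (Γ.parabolicPart X u)⁻¹ * Γ.parabolicPart X (u * Γ.theta a) := by
  have ha : a ∈ Subgroup.closure (Set.range Γ.artinGen) := by
    have : Subgroup.closure (Set.range Γ.artinGen) = ⊤ := PresentedGroup.closure_range_of _
    rw [this]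
    trivial
  induction ha using Subgroup.closure_induction generalizing u with
  | mem a ha =>
    obtain ⟨z, rfl⟩ := ha
    rw [output_artinGen, theta_artinGen]
    rcases Γ.outLetter_cases X u z with ⟨x, -, ho, hp⟩ | ⟨ho, hp⟩ <;>
      simp [ho, hp, artinInclusion_artinGen, theta_artinGen]
  | one => simp [output_one]
  | mul a b _ _ iha ihb => simp [output_mul, iha, ihb, mul_assoc]
  | inv a _ ih => simp [output_inv, ih]

/-- Points of W_X have minimal part 1, so letters of X are copied. The second conclusion keeps the
tracked point in W_X along the induction. -/
theorem artinInclusion_output {u : Γ.CoxeterGroup} (hu : u ∈ Γ.coxeterSystem.parabolic X)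
    {a : Γ.ArtinGroup} (ha : a ∈ Γ.artinParabolic X) :
    Γ.artinInclusion X (Γ.output X u a) = a ∧ Γ.theta a ∈ Γ.coxeterSystem.parabolic X := by
  induction ha using Subgroup.closure_induction generalizing u with
  | mem a ha =>
    obtain ⟨z, hz, rfl⟩ := ha
    have hm : Γ.minimalPart X u = 1 := by
      conv_lhs => rw [← mul_one u]
      exact Γ.minimalPart_eq hu (Γ.coxeterSystem.isCosetMin_one X)
    have hb : Γ.letterBase X u z true = 1 := hm
    rw [theta_artinGen, output_artinGen, outLetter,
      Γ.piHatLetter_eq X (x := ⟨z, hz⟩) (by rw [hb]; simp)]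
    exact ⟨by simp [artinInclusion_artinGen], Γ.coxeterSystem.simple_mem_parabolic hz⟩
  | one => exact ⟨by simp [output_one], by simp⟩
  | mul a b _ _ iha ihb =>
    have h1 := iha hu
    have h2 := ihb (mul_mem hu h1.2)
    exact ⟨by rw [output_mul, map_mul, h1.1, h2.1], by
      rw [map_mul]
      exact mul_mem h1.2 h2.2⟩
  | inv a _ ih =>
    have h1 := (ih hu).2
    exact ⟨by rw [output_inv, map_inv, (ih (mul_mem hu (inv_mem h1))).1], by
      rw [map_inv]
      exact inv_mem h1⟩

/-- The set map `A → A_X` induced by `piHat`. -/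
def artinProjection (a : Γ.ArtinGroup) : Γ.artinParabolic X :=
  ⟨Γ.artinInclusion X (Γ.output X 1 a), Γ.artinInclusion_mem X _⟩

theorem isInducedByPiHat_artinProjection : Γ.IsInducedByPiHat X (Γ.artinProjection X) := by
  intro α
  rw [piHat, ← artinInclusion_artinWord, artinWord_piHatFrom]
  rfl

variable {X} in
theorem IsInducedByPiHat.eq {Γ : LabeledGraph V} {π : Γ.ArtinGroup → Γ.artinParabolic X}
    (h : Γ.IsInducedByPiHat X π) : π = Γ.artinProjection X := by
  ext a
  obtain ⟨α, rfl⟩ := Γ.artinWord_surjective a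
  rw [h, Γ.isInducedByPiHat_artinProjection X]

/-- The restriction of the projection `A → A_X` to the colored Artin group. -/
def coloredProjection : Γ.coloredArtin →* Γ.coloredArtinParabolic X where
  toFun a := ⟨Γ.artinProjection X a, by
    refine ⟨?_, (Γ.artinProjection X a).2⟩
    have ha : Γ.theta a = 1 := a.2
    change Γ.theta (Γ.artinInclusion X (Γ.output X 1 a)) = 1
    rw [theta_artinInclusion_output, ha, mul_one, inv_mul_cancel]⟩
  map_one' := by
    ext
    simp [artinProjection, output_one]
  map_mul' a b := by
    have ha : Γ.theta a = 1 := a.2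
    ext
    -- As θ(a) = 1, the reading of b starts at 1 again.
    simp [artinProjection, output_mul, ha]

end LabeledGraph

end

theorem proposition2p3 {V : Type*} [Finite V] (Γ : LabeledGraph V) (X : Set V) :
    -- words that agree in `A` have images that agree in `A[Γ_X]`
    (∀ α β : List (V × Bool), Γ.artinWord α = Γ.artinWord β →
      (Γ.induce X).artinWord (Γ.piHat X α) = (Γ.induce X).artinWord (Γ.piHat X β)) ∧
    -- the map on words induces a set map `π : A → A_X`
    (∃! π : Γ.ArtinGroup → Γ.artinParabolic X, Γ.IsInducedByPiHat X π) ∧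
    ∀ π : Γ.ArtinGroup → Γ.artinParabolic X, Γ.IsInducedByPiHat X π →
      -- it is the identity on `A_X`
      (∀ α : Γ.artinParabolic X, π α = α) ∧
      -- it restricts to a homomorphism `CA → CA_X`
      ∃ f : Γ.coloredArtin →* Γ.coloredArtinParabolic X,
        ∀ α : Γ.coloredArtin, (f α : Γ.ArtinGroup) = π α := by
  refine ⟨fun α β h => ?_, ⟨Γ.artinProjection X, Γ.isInducedByPiHat_artinProjection X,
    fun π hπ => hπ.eq⟩, ?_⟩
  · rw [LabeledGraph.piHat, LabeledGraph.piHat, Γ.artinWord_piHatFrom, Γ.artinWord_piHatFrom, h]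
  · intro π hπ
    obtain rfl := hπ.eq
    exact ⟨fun α => Subtype.ext (Γ.artinInclusion_output X (one_mem _) α.2).1,
      Γ.coloredProjection X, fun α => rfl⟩
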